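/- All graphs are finite, simple and non-empty. A \emph{dominating $K_t$-model} in a graph $G$ is a sequence $(T_1,\dots,T_t)$ of pairwise vertex-disjoint non-empty connected subgraphs of $G$ such that, for all $1\le i<j\le t$, every vertex of $T_j$ has a neighbour (in $G$) in $T_i$. For every real $\varepsilon>0$ there is an integer $t_0$ such that, for every integer $t\ge t_0$, there is a graph $G$ that has no dominating $K_t$-model and whose average degree $\frac{1}{|V(G)|}\sum_{v\in V(G)}\deg_G(v)$ is at least $(1-\varepsilon)\,t\ln t$. -/

import Mathlib

namespace SimpleGraph

/-- A dominating `K_t`-model in `G`: a sequence of `t` pairwise vertex-disjoint, (non-empty)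
connected subgraphs `T 0, …, T (t-1)` of `G` such that for `i < j` every vertex of `T j` has a
neighbour (in `G`) in `T i`. `SimpleGraph.Subgraph.Connected` includes non-emptiness. -/
structure IsDominatingModel {V : Type*} (G : SimpleGraph V) {t : ℕ}
    (T : Fin t → G.Subgraph) : Prop where
  connected : ∀ i, (T i).Connected
  disjoint : ∀ i j, i ≠ j → Disjoint (T i).verts (T j).verts
  dominating : ∀ i j, i < j → ∀ v ∈ (T j).verts, ∃ u ∈ (T i).verts, G.Adj v u

/-- `G` has a dominating `K_t`-model. -/
def HasDominatingModel {V : Type*} (G : SimpleGraph V) (t : ℕ) : Prop :=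
  ∃ T : Fin t → G.Subgraph, G.IsDominatingModel T

open Classical in
/-- The average degree of a finite graph: the mean of the vertex degrees. -/
noncomputable def averageDegree {V : Type*} [Fintype V] (G : SimpleGraph V) : ℝ :=
  (∑ v : V, (G.degree v : ℝ)) / (Fintype.card V : ℝ)

end SimpleGraph

/-!
The graph is a binomial random graph with a small constant edge probability `p = 1 / (k + 1)`, on
`n ≈ (1 - 4δ) k t ln t` vertices, so that its average degree is about
`(1 - 4δ) (k / (k + 1)) t ln t`, which is close to `t ln t` for `δ` small and `k` large.

Probabilities are counted: a graph is a colouring of the pairs of vertices by `k + 1` colours, its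
edges being the pairs of colour `0`.

Let `q = 1 - p`. The parts of a dominating `K_t`-model are disjoint, so with `h ≈ δ t`, at least `h`
of the first `t - h` parts have at most `s ≈ n / (t - 2h)` vertices. Each of `h` vertices chosen
from the last `h` parts has a neighbour in each of these small parts
(`hasDominatedVertices_of_hasDominatingModel`). For fixed sets and vertices these `h ^ 2` events
concern disjoint sets of pairs, hence are independent (`card_forall_block_exists_zero`), and their
conjunction has probability at most `(1 - q ^ s) ^ (h ^ 2) ≤ exp (-h ^ 2 q ^ s)`. By the choice of
`n` one has `q ^ s ≥ t ^ (-(1 - 2δ))`, so the exponent `h ^ 2 q ^ s` is at least of order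
`h t ^ (2δ)`, which beats the logarithm `h (s + 1) ln n = O (h (ln t) ^ 2)` of the number of
choices. The union bound makes the probability of a model arbitrarily small, and a first-moment argument
(`exists_graph_not_hasDominatedVertices`) provides a graph without a model whose average degree is
almost the expected one.
-/

/-! ### Counting colourings -/

namespace DominatingModel

open Finset

/-- Among the `(k + 1) ^ |E|` colourings of `E`, those avoiding the colour `0` on `U` have
proportion `(k / (k + 1)) ^ |U|`. -/
lemma sum_prod_ne_zero {E : Type*} [Fintype E] [DecidableEq E] (k : ℕ) (U : Finset E) :
    ∑ f : E → Fin (k + 1), ∏ e ∈ U, (if f e ≠ 0 then (1 : ℝ) else 0) =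
      ((k : ℝ) + 1) ^ Fintype.card E * ((k : ℝ) / (k + 1)) ^ #U := by
  have hk : (k : ℝ) + 1 ≠ 0 := by positivity
  have h1 : ∀ f : E → Fin (k + 1), ∏ e ∈ U, (if f e ≠ 0 then (1 : ℝ) else 0) =
      ∏ e, if e ∈ U then (if f e ≠ 0 then (1 : ℝ) else 0) else 1 := by
    intro f
    rw [Finset.prod_ite_mem, Finset.univ_inter]
  have h2 : ∀ e : E, ∑ c : Fin (k + 1), (if e ∈ U then (if c ≠ 0 then (1 : ℝ) else 0) else 1) =
      ((k : ℝ) + 1) * (if e ∈ U then (k : ℝ) / (k + 1) else 1) := by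
    intro e
    split_ifs
    · rw [Fin.sum_univ_succ]
      simp
      field_simp
    · simp
  simp_rw [h1]
  rw [← Fintype.piFinset_univ, Finset.sum_prod_piFinset (s := univ)
    (g := fun e c => if e ∈ U then (if c ≠ 0 then (1 : ℝ) else 0) else 1)]
  simp_rw [h2]
  rw [Finset.prod_mul_distrib, Finset.prod_ite_mem, Finset.univ_inter, Finset.prod_const,
    Finset.prod_const, Finset.card_univ]

/-- For pairwise disjoint blocks the events "block `B i` contains the colour `0`" are independent.
Both sides are expanded over the subsets of `I`. -/
lemma card_forall_block_exists_zero {E ι : Type*} [Fintype E] [DecidableEq E] [DecidableEq ι]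
    (k : ℕ) (I : Finset ι) (B : ι → Finset E) (hB : (I : Set ι).PairwiseDisjoint B) :
    (#{f : E → Fin (k + 1) | ∀ i ∈ I, ∃ e ∈ B i, f e = 0} : ℝ) =
      ((k : ℝ) + 1) ^ Fintype.card E * ∏ i ∈ I, (1 - ((k : ℝ) / (k + 1)) ^ #(B i)) := by
  have h1 : ∀ f : E → Fin (k + 1), (if ∀ i ∈ I, ∃ e ∈ B i, f e = 0 then (1 : ℝ) else 0) =
      ∏ i ∈ I, (1 - ∏ e ∈ B i, (if f e ≠ 0 then (1 : ℝ) else 0)) := by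
    intro f
    simp_rw [Finset.prod_ite_zero, Finset.prod_const_one]
    split_ifs with h
    · refine (Finset.prod_eq_one fun i hi => ?_).symm
      obtain ⟨e, he, h0⟩ := h i hi
      rw [if_neg (fun h' => h' e he h0), sub_zero]
    · push Not at h
      obtain ⟨i, hi, h0⟩ := h
      refine (Finset.prod_eq_zero hi ?_).symm
      rw [if_pos h0, sub_self]
  rw [Finset.card_filter]
  push_cast
  -- Expand `∏ (1 - ·)`; on each `J ⊆ I` the product runs over the disjoint union of its blocks.
  simp_rw [h1, Finset.prod_sub, Finset.prod_const_one, mul_one]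
  rw [Finset.sum_comm, Finset.mul_sum]
  refine Finset.sum_congr rfl fun J hJ => ?_
  rw [← Finset.mul_sum]
  have hJB : (J : Set ι).PairwiseDisjoint B :=
    hB.subset (by exact_mod_cast Finset.mem_powerset.mp hJ)
  simp_rw [← Finset.prod_biUnion hJB]
  rw [sum_prod_ne_zero, Finset.card_biUnion hJB, Finset.prod_pow_eq_pow_sum]
  ring

/-- The graph whose edges are the pairs of colour `0`. For a uniformly random colouring this is the
binomial random graph with edge probability `1 / (k + 1)`. -/
def colourGraph {V : Type*} {k : ℕ} (f : Sym2 V → Fin (k + 1)) : SimpleGraph V :=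
  SimpleGraph.fromEdgeSet {e | f e = 0}

lemma colourGraph_adj {V : Type*} {k : ℕ} (f : Sym2 V → Fin (k + 1)) (v w : V) :
    (colourGraph f).Adj v w ↔ f s(v, w) = 0 ∧ v ≠ w := by
  simp [colourGraph]

lemma card_colour_eq_zero {E : Type*} [Fintype E] [DecidableEq E] (k : ℕ) (e : E) :
    (#{f : E → Fin (k + 1) | f e = 0} : ℝ) =
      ((k : ℝ) + 1) ^ Fintype.card E * (1 / ((k : ℝ) + 1)) := by
  have h := card_forall_block_exists_zero k {()} (fun _ => ({e} : Finset E)) (by simp)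
  simp only [Finset.mem_singleton, forall_const, exists_eq_left, Finset.prod_singleton,
    Finset.card_singleton, pow_one] at h
  rw [h]
  congr 1
  field_simp
  ring

open Classical in
/-- The expected average degree of the random graph is `(n - 1) / (k + 1)`. -/
lemma sum_averageDegree_colourGraph {V : Type*} [Fintype V] [Nonempty V] (k : ℕ) :
    ∑ f : Sym2 V → Fin (k + 1), (colourGraph f).averageDegree =
      ((k : ℝ) + 1) ^ Fintype.card (Sym2 V) * (((Fintype.card V : ℝ) - 1) / (k + 1)) := by
  have hn : (Fintype.card V : ℝ) ≠ 0 := by exact_mod_cast Fintype.card_ne_zero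
  have hdeg : ∀ (f : Sym2 V → Fin (k + 1)) (v : V), ((colourGraph f).degree v : ℝ) =
      ∑ w ∈ univ.erase v, if f s(v, w) = 0 then 1 else 0 := by
    intro f v
    rw [← SimpleGraph.card_neighborFinset_eq_degree, SimpleGraph.neighborFinset_eq_filter]
    simp only [colourGraph_adj]
    rw [Finset.sum_boole]
    congr 2
    ext w
    simp only [mem_filter, mem_univ, true_and, mem_erase, ne_comm, and_comm]
  simp only [SimpleGraph.averageDegree, ← Finset.sum_div]
  rw [div_eq_iff hn, Finset.sum_comm]
  simp only [hdeg]
  have h2 : ∀ v : V, ∑ f : Sym2 V → Fin (k + 1), ∑ w ∈ univ.erase v,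
      (if f s(v, w) = 0 then (1 : ℝ) else 0) =
      ((Fintype.card V : ℝ) - 1) * (((k : ℝ) + 1) ^ Fintype.card (Sym2 V) * (1 / (k + 1))) := by
    intro v
    rw [Finset.sum_comm]
    simp only [Finset.sum_boole, card_colour_eq_zero]
    rw [Finset.sum_const, Finset.card_erase_of_mem (mem_univ v), Finset.card_univ, nsmul_eq_mul,
      Nat.cast_sub Fintype.card_pos, Nat.cast_one]
  simp only [h2, Finset.sum_const, Finset.card_univ, nsmul_eq_mul]
  ring

open Classical in
lemma averageDegree_le {V : Type*} [Fintype V] [Nonempty V] (G : SimpleGraph V) :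
    G.averageDegree ≤ (Fintype.card V : ℝ) - 1 := by
  have hn : (0 : ℝ) < Fintype.card V := by exact_mod_cast Fintype.card_pos
  rw [SimpleGraph.averageDegree, div_le_iff₀ hn]
  calc ∑ v : V, (G.degree v : ℝ) ≤ ∑ _v : V, ((Fintype.card V : ℝ) - 1) := by
        refine Finset.sum_le_sum fun v _ => ?_
        have := G.degree_lt_card_verts v
        rw [le_sub_iff_add_le]
        exact_mod_cast this
    _ = _ := by simp; ring

/-- An obstruction that every dominating model contains: `h` pairwise disjoint sets of at most `s`
vertices, given as the ranges of `x i : Fin s → V`, and `h` further distinct vertices `y j`, such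
that each `y j` has a neighbour in each of the sets. -/
def HasDominatedVertices {V : Type*} (G : SimpleGraph V) (h s : ℕ) : Prop :=
  ∃ (x : Fin h → Fin s → V) (y : Fin h → V), Function.Injective y ∧
    (∀ i j a b, x i a = x j b → i = j) ∧ (∀ i j a, x i a ≠ y j) ∧
      ∀ i j, ∃ a, G.Adj (y j) (x i a)

open Classical in
/-- For fixed sets and vertices, the `h ^ 2` required adjacencies involve disjoint sets of pairs,
each of size at most `s`. -/
lemma card_colourings_dominating_le {V : Type*} [Fintype V] (k h s : ℕ)
    (x : Fin h → Fin s → V) (y : Fin h → V) (hy : Function.Injective y)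
    (hx : ∀ i j a b, x i a = x j b → i = j) (hxy : ∀ i j a, x i a ≠ y j) :
    (#{f : Sym2 V → Fin (k + 1) | ∀ i j, ∃ a, (colourGraph f).Adj (y j) (x i a)} : ℝ) ≤
      ((k : ℝ) + 1) ^ Fintype.card (Sym2 V) *
        (1 - ((k : ℝ) / (k + 1)) ^ s) ^ (h * h) := by
  have hq0 : (0 : ℝ) ≤ (k : ℝ) / (k + 1) := by positivity
  have hq1 : (k : ℝ) / (k + 1) ≤ 1 := by
    rw [div_le_one (by positivity)]; linarith
  let B : Fin h × Fin h → Finset (Sym2 V) := fun p => univ.image fun a => s(y p.2, x p.1 a)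
  have hB : ((univ : Finset (Fin h × Fin h)) : Set (Fin h × Fin h)).PairwiseDisjoint B := by
    rintro ⟨i, j⟩ - ⟨i', j'⟩ - hne
    simp only [Function.onFun]
    rw [Finset.disjoint_left]
    intro e he he'
    simp only [B, mem_image, mem_univ, true_and] at he he'
    obtain ⟨a, rfl⟩ := he
    obtain ⟨b, hb⟩ := he'
    rw [Sym2.eq_iff] at hb
    rcases hb with ⟨h1, h2⟩ | ⟨h1, h2⟩
    · exact hne (by rw [hy h1, hx _ _ _ _ h2])
    · exact hxy _ _ _ h2
  have hcard := card_forall_block_exists_zero k univ B hB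
  calc (#{f : Sym2 V → Fin (k + 1) | ∀ i j, ∃ a, (colourGraph f).Adj (y j) (x i a)} : ℝ)
      ≤ #{f : Sym2 V → Fin (k + 1) | ∀ p ∈ (univ : Finset (Fin h × Fin h)),
          ∃ e ∈ B p, f e = 0} := by
        refine Nat.cast_le.mpr (Finset.card_le_card fun f hf => ?_)
        simp only [mem_filter, mem_univ, true_and, forall_const] at hf ⊢
        rintro ⟨i, j⟩
        obtain ⟨a, ha⟩ := hf i j
        exact ⟨_, mem_image_of_mem _ (mem_univ a), ((colourGraph_adj _ _ _).mp ha).1⟩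
    _ = ((k : ℝ) + 1) ^ Fintype.card (Sym2 V) *
          ∏ p ∈ (univ : Finset (Fin h × Fin h)), (1 - ((k : ℝ) / (k + 1)) ^ #(B p)) := by
        convert hcard
    _ ≤ _ := by
        refine mul_le_mul_of_nonneg_left ?_ (by positivity)
        calc ∏ p ∈ (univ : Finset (Fin h × Fin h)), (1 - ((k : ℝ) / (k + 1)) ^ #(B p))
            ≤ ∏ _p ∈ (univ : Finset (Fin h × Fin h)), (1 - ((k : ℝ) / (k + 1)) ^ s) := by
              refine Finset.prod_le_prod (fun p _ => ?_) fun p _ => ?_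
              · exact sub_nonneg.mpr (pow_le_one₀ hq0 hq1)
              · refine sub_le_sub_left (pow_le_pow_of_le_one hq0 hq1 ?_) _
                exact Finset.card_image_le.trans (by simp)
          _ = _ := by simp

open Classical in
/-- The union bound over the `n ^ (h * (s + 1))` choices of sets and vertices. -/
lemma card_hasDominatedVertices_le {V : Type*} [Fintype V] (k h s : ℕ) :
    (#{f : Sym2 V → Fin (k + 1) | HasDominatedVertices (colourGraph f) h s} : ℝ) ≤
      ((k : ℝ) + 1) ^ Fintype.card (Sym2 V) *
        ((Fintype.card V : ℝ) ^ (h * (s + 1)) * (1 - ((k : ℝ) / (k + 1)) ^ s) ^ (h * h)) := by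
  let C : Finset ((Fin h → Fin s → V) × (Fin h → V)) :=
    {c | Function.Injective c.2 ∧ (∀ i j a b, c.1 i a = c.1 j b → i = j) ∧
      ∀ i j a, c.1 i a ≠ c.2 j}
  let F : (Fin h → Fin s → V) × (Fin h → V) → Finset (Sym2 V → Fin (k + 1)) := fun c =>
    {f | ∀ i j, ∃ a, (colourGraph f).Adj (c.2 j) (c.1 i a)}
  have hq0 : (0 : ℝ) ≤ (k : ℝ) / (k + 1) := by positivity
  have hq1 : (k : ℝ) / (k + 1) ≤ 1 := by
    rw [div_le_one (by positivity)]; linarith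
  have hC : (#C : ℝ) ≤ (Fintype.card V : ℝ) ^ (h * (s + 1)) := by
    have : #C ≤ Fintype.card V ^ (h * (s + 1)) := by
      refine (Finset.card_le_univ _).trans (le_of_eq ?_)
      simp only [Fintype.card_prod, Fintype.card_fun, Fintype.card_fin]
      rw [← pow_mul, ← pow_add]
      congr 1
      ring
    exact_mod_cast this
  calc (#{f : Sym2 V → Fin (k + 1) | HasDominatedVertices (colourGraph f) h s} : ℝ)
      ≤ #(C.biUnion F) := by
        refine Nat.cast_le.mpr (Finset.card_le_card fun f hf => ?_)
        simp only [mem_filter, mem_univ, true_and, mem_biUnion, C, F] at hf ⊢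
        obtain ⟨x, y, h1, h2, h3, h4⟩ := hf
        exact ⟨(x, y), ⟨h1, h2, h3⟩, h4⟩
    _ ≤ ∑ c ∈ C, (#(F c) : ℝ) := by exact_mod_cast Finset.card_biUnion_le
    _ ≤ ∑ _c ∈ C, ((k : ℝ) + 1) ^ Fintype.card (Sym2 V) *
          (1 - ((k : ℝ) / (k + 1)) ^ s) ^ (h * h) := by
        refine Finset.sum_le_sum fun c hc => ?_
        obtain ⟨h1, h2, h3⟩ := (mem_filter.mp hc).2
        exact card_colourings_dominating_le k h s c.1 c.2 h1 h2 h3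
    _ = #C * (((k : ℝ) + 1) ^ Fintype.card (Sym2 V) *
          (1 - ((k : ℝ) / (k + 1)) ^ s) ^ (h * h)) := by
        rw [Finset.sum_const, nsmul_eq_mul]
    _ ≤ (Fintype.card V : ℝ) ^ (h * (s + 1)) * (((k : ℝ) + 1) ^ Fintype.card (Sym2 V) *
          (1 - ((k : ℝ) / (k + 1)) ^ s) ^ (h * h)) := by
        refine mul_le_mul_of_nonneg_right hC (mul_nonneg (by positivity) (pow_nonneg ?_ _))
        exact sub_nonneg.mpr (pow_le_one₀ hq0 hq1)
    _ = _ := by ring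

/-- First-moment argument: if the obstruction has probability at most `π < 1 / (k + 1)`, some
graph avoids it and has average degree at least `(1 / (k + 1) - π) (n - 1)`. Discarding a colouring
costs at most `n - 1`, so no concentration of the number of edges is needed. -/
lemma exists_graph_not_hasDominatedVertices {V : Type*} [Fintype V] (hV : 1 < Fintype.card V)
    (k h s : ℕ) (π : ℝ) (hπ : π < 1 / ((k : ℝ) + 1))
    (hbad : (Fintype.card V : ℝ) ^ (h * (s + 1)) *
      (1 - ((k : ℝ) / (k + 1)) ^ s) ^ (h * h) ≤ π) :
    ∃ G : SimpleGraph V, ¬ HasDominatedVertices G h s ∧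
      (1 / ((k : ℝ) + 1) - π) * ((Fintype.card V : ℝ) - 1) ≤ G.averageDegree := by
  classical
  have : Nonempty V := Fintype.card_pos_iff.mp (by omega)
  have hn : (0 : ℝ) < (Fintype.card V : ℝ) - 1 := by
    rw [sub_pos]; exact_mod_cast hV
  set N : ℝ := ((k : ℝ) + 1) ^ Fintype.card (Sym2 V) with hN
  have hNpos : 0 < N := by positivity
  have hc := card_hasDominatedVertices_le (V := V) k h s
  -- Sum over all colourings: average degree, less `n - 1` when the obstruction occurs.
  have key : ∑ _f : Sym2 V → Fin (k + 1),
      (1 / ((k : ℝ) + 1) - π) * ((Fintype.card V : ℝ) - 1) ≤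
      ∑ f : Sym2 V → Fin (k + 1), ((colourGraph f).averageDegree -
        if HasDominatedVertices (colourGraph f) h s then (Fintype.card V : ℝ) - 1 else 0) := by
    rw [Finset.sum_sub_distrib, sum_averageDegree_colourGraph, ← Finset.sum_filter,
      Finset.sum_const, Finset.sum_const, nsmul_eq_mul, nsmul_eq_mul, Finset.card_univ,
      Fintype.card_fun, Fintype.card_fin]
    push_cast
    rw [← hN] at hc ⊢
    have h1 := hc.trans (mul_le_mul_of_nonneg_left hbad hNpos.le)
    have h2 := mul_le_mul_of_nonneg_right h1 hn.le
    have h3 : N * ((1 / ((k : ℝ) + 1) - π) * ((Fintype.card V : ℝ) - 1)) =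
      N * (((Fintype.card V : ℝ) - 1) / (k + 1)) - N * π * ((Fintype.card V : ℝ) - 1) := by ring
    rw [h3]
    linarith
  obtain ⟨f, -, hf⟩ := Finset.exists_le_of_sum_le univ_nonempty key
  have hpos : 0 < (1 / ((k : ℝ) + 1) - π) * ((Fintype.card V : ℝ) - 1) :=
    mul_pos (sub_pos.mpr hπ) hn
  refine ⟨colourGraph f, fun hd => ?_, ?_⟩
  · rw [if_pos hd] at hf
    have := averageDegree_le (colourGraph f)
    linarith
  · split_ifs at hf <;> linarith

end DominatingModel

/-! ### Small parts of a dominating model -/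

namespace DominatingModel

open Finset

lemma exists_range_eq_of_card_le {V : Type*} (S : Finset V) (hS : S.Nonempty) (s : ℕ)
    (hs : #S ≤ s) : ∃ g : Fin s → V, Set.range g = S := by
  have : Nonempty S := hS.to_subtype
  obtain ⟨φ⟩ : Nonempty (S ↪ Fin s) :=
    Function.Embedding.nonempty_of_card_le (by simpa using hs)
  refine ⟨fun a => (Function.invFun φ a : S), ?_⟩
  ext v
  constructor
  · rintro ⟨a, rfl⟩
    exact (Function.invFun φ a).2
  · intro hv
    exact ⟨φ ⟨v, hv⟩, by simp [Function.leftInverse_invFun φ.injective _]⟩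

/-- Fewer than `t - 2h` of the first `t - h` parts have more than `s` vertices, so `h` of them are
small; the vertices to be dominated are taken from the last `h` parts. -/
lemma hasDominatedVertices_of_hasDominatingModel {V : Type*} [Fintype V] {G : SimpleGraph V}
    {t : ℕ} (hG : G.HasDominatingModel t) (h s : ℕ) (ht : 2 * h ≤ t)
    (hcard : Fintype.card V < (s + 1) * (t - 2 * h)) : HasDominatedVertices G h s := by
  classical
  obtain ⟨T, hT⟩ := hG
  let S : Fin t → Finset V := fun i => (T i).verts.toFinset
  have hmem : ∀ i v, v ∈ S i ↔ v ∈ (T i).verts := fun i v => Set.mem_toFinset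
  have hSne : ∀ i, (S i).Nonempty := fun i => by
    obtain ⟨v, hv⟩ := (hT.connected i).nonempty
    exact ⟨v, (hmem i v).mpr hv⟩
  have hSdisj : ∀ i j v, v ∈ S i → v ∈ S j → i = j := by
    intro i j v hi hj
    by_contra hij
    exact Set.disjoint_left.mp (hT.disjoint i j hij) ((hmem i v).mp hi) ((hmem j v).mp hj)
  let A : Finset (Fin t) := {i | i.val < t - h}
  have hA : #A = t - h := by
    rw [Fin.card_filter_val_lt]
    omega
  have hsmall : h ≤ #{i ∈ A | #(S i) ≤ s} := by
    by_contra! hlt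
    have hsum := Finset.card_filter_add_card_filter_not (s := A) (fun i => #(S i) ≤ s)
    have hlarge : t - 2 * h ≤ #{i ∈ A | ¬ #(S i) ≤ s} := by omega
    have h1 : ∑ i ∈ A with ¬ #(S i) ≤ s, #(S i) ≤ Fintype.card V := by
      rw [← Finset.card_biUnion]
      · exact Finset.card_le_univ _
      · intro i _ j _ hij
        simp only [Function.onFun]
        rw [Finset.disjoint_left]
        exact fun v hi hj => hij (hSdisj i j v hi hj)
    have h2 : #{i ∈ A | ¬ #(S i) ≤ s} * (s + 1) ≤ ∑ i ∈ A with ¬ #(S i) ≤ s, #(S i) := by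
      rw [← smul_eq_mul]
      refine Finset.card_nsmul_le_sum _ _ _ fun i hi => ?_
      have := (mem_filter.mp hi).2
      omega
    have h3 := Nat.mul_le_mul_right (s + 1) hlarge
    rw [mul_comm (s + 1)] at hcard
    omega
  obtain ⟨M, hM, hMcard⟩ := Finset.exists_subset_card_eq hsmall
  let e : Fin h ↪o Fin t := M.orderEmbOfFin hMcard
  have he : ∀ i, (e i).val < t - h ∧ #(S (e i)) ≤ s := fun i => by
    have := hM (M.orderEmbOfFin_mem hMcard i)
    simpa [A] using this
  choose g hg using fun i : Fin h => exists_range_eq_of_card_le (S (e i)) (hSne _) s (he i).2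
  have hgS : ∀ i a, g i a ∈ S (e i) := fun i a => by
    have : g i a ∈ Set.range (g i) := ⟨a, rfl⟩
    rw [hg i] at this
    exact this
  let l : Fin h → Fin t := fun j => ⟨t - h + j, by omega⟩
  have hl : ∀ i j, e i < l j := fun i j => by
    have := (he i).1
    rw [Fin.lt_def]
    exact this.trans_le (Nat.le_add_right _ _)
  choose y hy using fun j : Fin h => hSne (l j)
  refine ⟨g, y, ?_, ?_, ?_, ?_⟩
  · intro j j' hjj'
    have h1 := hSdisj (l j) (l j') (y j) (hy j) (hjj' ▸ hy j')
    have h2 := congrArg Fin.val h1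
    simp only [l] at h2
    exact Fin.ext (by omega)
  · intro i j a b hab
    exact e.injective (hSdisj _ _ _ (hgS i a) (hab ▸ hgS j b))
  · intro i j a hay
    exact (hl i j).ne (hSdisj _ _ _ (hgS i a) (hay ▸ hy j))
  · intro i j
    obtain ⟨u, hu, hadj⟩ := hT.dominating _ _ (hl i j) (y j) ((hmem _ _).mp (hy j))
    have : u ∈ Set.range (g i) := by
      rw [hg i]
      exact (hmem _ _).mpr hu
    obtain ⟨a, rfl⟩ := this
    exact ⟨a, hadj⟩

end DominatingModel

/-! ### Choice of parameters -/

namespace DominatingModel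

open Filter

lemma exp_neg_inv_le_div {k : ℕ} (hk : 0 < k) :
    Real.exp (-(1 / (k : ℝ))) ≤ (k : ℝ) / (k + 1) := by
  have hk' : (0 : ℝ) < k := by exact_mod_cast hk
  rw [Real.exp_neg, inv_le_comm₀ (Real.exp_pos _) (by positivity), inv_div, add_div,
    div_self hk'.ne']
  linarith [Real.add_one_le_exp (1 / (k : ℝ))]

/-- In terms of `L = ln t`: the entropy of a choice of small sets is quadratic in `L`, while the
exponent gained from the adjacencies is `t ^ (2δ)`. -/
lemma eventually_quadratic_le_exp (k : ℕ) (hk : 0 < k) (C δ : ℝ) (hC : 0 ≤ C) (hδ : 0 < δ) :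
    ∀ᶠ L : ℝ in atTop, (k * L + 1) * (Real.log k + 2 * L) + C ≤
      δ / 2 * Real.exp (2 * δ * L) := by
  have hlog : 0 ≤ Real.log k := Real.log_natCast_nonneg k
  set K : ℝ := (k + 1) * (Real.log k + 2) + C with hK
  have hk0 : (0 : ℝ) < k := by exact_mod_cast hk
  have hKpos : 0 < K := by positivity
  have h := (isLittleO_pow_exp_pos_mul_atTop 2 (b := 2 * δ) (by positivity)).bound
    (c := δ / 2 / K) (by positivity)
  filter_upwards [h, eventually_ge_atTop 1] with L hL h1
  rw [Real.norm_of_nonneg (by positivity), Real.norm_of_nonneg (Real.exp_pos _).le] at hL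
  calc (k * L + 1) * (Real.log k + 2 * L) + C
      ≤ (k * L + L) * (Real.log k * L + 2 * L) + C * L ^ 2 := by
        have h2 : Real.log k ≤ Real.log k * L := le_mul_of_one_le_right hlog h1
        have h3 : C ≤ C * L ^ 2 := le_mul_of_one_le_right hC (one_le_pow₀ h1)
        gcongr
    _ = K * L ^ 2 := by rw [hK]; ring
    _ ≤ K * (δ / 2 / K * Real.exp (2 * δ * L)) := by gcongr
    _ = δ / 2 * Real.exp (2 * δ * L) := by field_simp

/-- The union bound for the obstruction, in the exponential form in which it is applied. -/
lemma pow_mul_one_sub_pow_le {n h s : ℕ} {q E C : ℝ} (hn : 0 < n) (hh : 1 ≤ h) (hq : q ≤ 1)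
    (hC : 1 ≤ C) (hE : E ≤ h * q) (hle : ((s : ℝ) + 1) * Real.log n + Real.log C ≤ E) :
    (n : ℝ) ^ (h * (s + 1)) * (1 - q) ^ (h * h) ≤ 1 / C := by
  have hn' : (0 : ℝ) < n := by exact_mod_cast hn
  have hC0 : 0 < C := by linarith
  have hh' : (1 : ℝ) ≤ h := by exact_mod_cast hh
  have hlogC : 0 ≤ Real.log C := Real.log_nonneg hC
  calc (n : ℝ) ^ (h * (s + 1)) * (1 - q) ^ (h * h)
      ≤ Real.exp (Real.log n) ^ (h * (s + 1)) * Real.exp (-q) ^ (h * h) := by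
        rw [Real.exp_log hn']
        have := Real.one_sub_le_exp_neg q
        have h0 : 0 ≤ 1 - q := by linarith
        gcongr
    _ = Real.exp (h * (((s : ℝ) + 1) * Real.log n - h * q)) := by
        rw [← Real.exp_nat_mul, ← Real.exp_nat_mul, ← Real.exp_add]
        push_cast
        congr 1
        ring
    _ ≤ Real.exp (-Real.log C) := by
        refine Real.exp_le_exp.mpr ?_
        have h1 : (h : ℝ) * (((s : ℝ) + 1) * Real.log n - h * q) ≤ h * (-Real.log C) := by
          refine mul_le_mul_of_nonneg_left ?_ (by positivity)
          linarith
        have h2 := mul_le_mul_of_nonneg_right hh' hlogC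
        linarith
    _ = 1 / C := by rw [Real.exp_neg, Real.exp_log hC0, one_div]

/-- The average degree `(1 - δ) (n - 1) / (k + 1)` is within a factor `1 - 7δ` of `X = t ln t`,
because `k / (k + 1) ≥ 1 - δ`. -/
lemma one_sub_mul_le_average {δ X : ℝ} {k n : ℕ} (hδ : 0 < δ) (hδ1 : δ ≤ 1 / 10)
    (hkδ : 1 ≤ k * δ) (hX : 0 < X) (h2 : 2 ≤ δ * X)
    (hnlt : (1 - 4 * δ) * (k * X) ≤ n + 1) :
    (1 - 7 * δ) * X ≤ (1 / ((k : ℝ) + 1) - δ / (k + 1)) * ((n : ℝ) - 1) := by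
  rw [← sub_div, div_mul_eq_mul_div, le_div_iff₀ (by positivity)]
  have h1 : (1 - δ) * ((k : ℝ) + 1) ≤ k := by linarith
  have h4 : 0 ≤ 1 - 4 * δ := by linarith
  have h3 : (1 - 4 * δ) * ((1 - δ) * ((k : ℝ) + 1)) * X ≤
      (1 - 4 * δ) * k * X := by gcongr
  have h5 : (1 - 6 * δ) * ((k : ℝ) + 1) * X ≤ n - 1 := by
    have h6 : 2 ≤ δ * ((k : ℝ) + 1) * X := by
      calc (2 : ℝ) ≤ δ * X := h2
        _ ≤ δ * X * (k + 1) := le_mul_of_one_le_right (by positivity) (by linarith)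
        _ = _ := by ring
    have h7 : (1 - 6 * δ) * ((k : ℝ) + 1) * X + δ * ((k : ℝ) + 1) * X ≤
        (1 - 4 * δ) * ((1 - δ) * ((k : ℝ) + 1)) * X := by
      rw [← add_mul]
      refine mul_le_mul_of_nonneg_right ?_ hX.le
      have : 0 ≤ δ ^ 2 * ((k : ℝ) + 1) := by positivity
      linarith
    linarith
  calc (1 - 7 * δ) * X * ((k : ℝ) + 1)
      ≤ (1 - δ) * ((1 - 6 * δ) * ((k : ℝ) + 1) * X) := by
        have : 0 ≤ δ ^ 2 * (((k : ℝ) + 1) * X) := by positivity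
        linarith
    _ ≤ (1 - δ) * (n - 1) := mul_le_mul_of_nonneg_left h5 (by linarith)

/-- With `n ≈ (1 - 4δ) k t ln t` vertices, sets of size at most `s = n / (t - 2h)`, where `h ≈ δ t`,
miss a given vertex with probability at least `(k / (k + 1)) ^ s ≥ t ^ (-(1 - 2δ))`. -/
lemma exists_graph_of_large {δ : ℝ} {k t : ℕ} (hδ : 0 < δ) (hδ1 : δ ≤ 1 / 10)
    (hk : 1 / δ ≤ k) (hL : 1 ≤ Real.log t) (ht : 2 ≤ δ * t)
    (hexp : (k * Real.log t + 1) * (Real.log k + 2 * Real.log t) + Real.log ((k + 1) / δ) ≤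
      δ / 2 * Real.exp (2 * δ * Real.log t)) :
    ∃ n : ℕ, 0 < n ∧ ∃ G : SimpleGraph (Fin n), ¬ G.HasDominatingModel t ∧
      (1 - 7 * δ) * (t * Real.log t) ≤ G.averageDegree := by
  set L := Real.log t with hLdef
  have hkδ : 1 ≤ k * δ := by rwa [div_le_iff₀ hδ] at hk
  have hk10 : (10 : ℝ) ≤ k := by
    have h1 : (1 : ℝ) * k ≤ 10 * k := by nlinarith
    nlinarith
  have hk0 : 0 < k := by
    have : (0 : ℝ) < k := by linarith
    exact_mod_cast this
  have ht20 : (20 : ℝ) ≤ t := by nlinarith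
  have ht0 : (0 : ℝ) < t := by linarith
  have hexpL : Real.exp L = t := Real.exp_log ht0
  have htL : (t : ℝ) ≤ t * L := le_mul_of_one_le_right ht0.le hL
  set h := ⌊δ * t⌋₊ with hh
  have hhle : (h : ℝ) ≤ δ * t := Nat.floor_le (by positivity)
  have hhlt : δ * t < h + 1 := Nat.lt_floor_add_one _
  have hhge : δ * t / 2 ≤ h := by linarith
  have hh1 : 1 ≤ h := by
    have : (0 : ℝ) < h := by linarith
    exact_mod_cast this
  have hht : 2 * h < t := by
    have : (2 : ℝ) * h < t := by nlinarith
    exact_mod_cast this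
  -- Since `-ln q ≤ 1 / k` for `q = k / (k + 1)`, this makes `q ^ (n / t)` at least `t ^ (4δ - 1)`.
  set n := ⌊(1 - 4 * δ) * (k * (t * L))⌋₊ with hn
  have h4 : 0 < 1 - 4 * δ := by linarith
  have hnle : (n : ℝ) ≤ (1 - 4 * δ) * (k * (t * L)) := Nat.floor_le (by positivity)
  have hnlt : (1 - 4 * δ) * (k * (t * L)) < n + 1 := Nat.lt_floor_add_one _
  have hkt : (200 : ℝ) ≤ k * (t * L) := by nlinarith
  have hn1 : 1 < n := by
    have : (1 : ℝ) < n := by nlinarith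
    exact_mod_cast this
  set s := n / (t - 2 * h) with hs
  have hns : n < (s + 1) * (t - 2 * h) := by
    rw [mul_comm]
    exact Nat.lt_mul_div_succ n (by omega)
  have hsle : (s : ℝ) ≤ (1 - 2 * δ) * (k * L) := by
    have h1 : (s : ℝ) * (t - 2 * h) ≤ n := by
      have := Nat.div_mul_le_self n (t - 2 * h)
      rw [← hs] at this
      have h2 : ((s * (t - 2 * h) : ℕ) : ℝ) ≤ n := by exact_mod_cast this
      rw [Nat.cast_mul, Nat.cast_sub hht.le] at h2
      push_cast at h2
      exact h2
    have h2 : (s : ℝ) * ((1 - 2 * δ) * t) ≤ s * (t - 2 * h) := by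
      refine mul_le_mul_of_nonneg_left ?_ (by positivity)
      linarith
    have h3 : (1 - 4 * δ) * (k * (t * L)) ≤ (1 - 2 * δ) ^ 2 * (k * (t * L)) := by
      refine mul_le_mul_of_nonneg_right ?_ (by positivity)
      nlinarith
    have h4 : (0 : ℝ) < (1 - 2 * δ) * t := mul_pos (by linarith) ht0
    refine le_of_mul_le_mul_right ?_ h4
    calc (s : ℝ) * ((1 - 2 * δ) * t) ≤ (1 - 2 * δ) ^ 2 * (k * (t * L)) := by linarith
      _ = _ := by ring
  have hskL : (s : ℝ) ≤ k * L := by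
    have : 0 ≤ k * L := by positivity
    nlinarith
  have hqs : Real.exp (-((1 - 2 * δ) * L)) ≤ ((k : ℝ) / (k + 1)) ^ s := by
    calc Real.exp (-((1 - 2 * δ) * L)) ≤ Real.exp (s * (-(1 / (k : ℝ)))) := by
          refine Real.exp_le_exp.mpr ?_
          have hk' : (0 : ℝ) < k := by linarith
          have : (s : ℝ) / k ≤ (1 - 2 * δ) * L := by
            rw [div_le_iff₀ hk']
            linarith
          calc -((1 - 2 * δ) * L) ≤ -((s : ℝ) / k) := by linarith
            _ = _ := by ring
      _ = Real.exp (-(1 / (k : ℝ))) ^ s := by rw [Real.exp_nat_mul]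
      _ ≤ _ := pow_le_pow_left₀ (Real.exp_pos _).le (exp_neg_inv_le_div hk0) s
  have hgain : δ / 2 * Real.exp (2 * δ * L) ≤ h * ((k : ℝ) / (k + 1)) ^ s := by
    calc δ / 2 * Real.exp (2 * δ * L) = δ * t / 2 * Real.exp (-((1 - 2 * δ) * L)) := by
          rw [← hexpL, show 2 * δ * L = L + -((1 - 2 * δ) * L) by ring, Real.exp_add]
          ring
      _ ≤ _ := by gcongr
  have hlogn : Real.log n ≤ Real.log k + 2 * L := by
    have hn0 : (0 : ℝ) < n := by exact_mod_cast (by omega : 0 < n)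
    have h1 : (n : ℝ) ≤ k * (t * L) := by nlinarith
    have hLt : L ≤ t := (Real.log_le_sub_one_of_pos ht0).trans (by linarith)
    have h2 : (n : ℝ) ≤ k * (t * t) := h1.trans (by gcongr)
    calc Real.log n ≤ Real.log (k * (t * t)) := Real.log_le_log hn0 h2
      _ = Real.log k + 2 * L := by
        rw [Real.log_mul (by positivity) (by positivity), Real.log_mul ht0.ne' ht0.ne']
        ring
  have hC1 : 1 ≤ ((k : ℝ) + 1) / δ := by
    rw [le_div_iff₀ hδ]
    linarith
  have hq1 : (k : ℝ) / (k + 1) ≤ 1 := by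
    rw [div_le_one (by positivity)]
    linarith
  have hbad : (n : ℝ) ^ (h * (s + 1)) * (1 - ((k : ℝ) / (k + 1)) ^ s) ^ (h * h) ≤
      1 / (((k : ℝ) + 1) / δ) := by
    refine pow_mul_one_sub_pow_le (by omega) hh1 (pow_le_one₀ (by positivity) hq1) hC1 hgain ?_
    refine le_trans ?_ hexp
    have : 0 ≤ Real.log n := Real.log_natCast_nonneg n
    gcongr
  rw [one_div_div] at hbad
  have hπ : δ / ((k : ℝ) + 1) < 1 / (k + 1) := by
    gcongr
    linarith
  obtain ⟨G, hG, hdeg⟩ := exists_graph_not_hasDominatedVertices (V := Fin n) (by simpa using hn1)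
    k h s _ hπ (by simpa using hbad)
  rw [Fintype.card_fin] at hdeg
  refine ⟨n, by omega, G, fun hmodel => hG ?_, le_trans ?_ hdeg⟩
  · exact hasDominatedVertices_of_hasDominatingModel hmodel h s hht.le (by simpa using hns)
  · exact one_sub_mul_le_average hδ hδ1 hkδ (by linarith)
      (ht.trans (mul_le_mul_of_nonneg_left htL hδ.le)) hnlt.le

end DominatingModel

open Filter in
theorem mainTheorem9 (ε : ℝ) (hε : 0 < ε) :
    ∃ t₀ : ℕ, ∀ t : ℕ, t₀ ≤ t →
      ∃ n : ℕ, 0 < n ∧ ∃ G : SimpleGraph (Fin n),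
        ¬ G.HasDominatingModel t ∧
          (1 - ε) * (t : ℝ) * Real.log (t : ℝ) ≤ G.averageDegree := by
  obtain ⟨δ, hδ, hδ1, hδε⟩ : ∃ δ : ℝ, 0 < δ ∧ δ ≤ 1 / 10 ∧ 7 * δ ≤ ε :=
    ⟨min (1 / 10) (ε / 7), by positivity, min_le_left _ _, by
      linarith [min_le_right (1 / 10 : ℝ) (ε / 7)]⟩
  obtain ⟨k, hk⟩ := exists_nat_ge (1 / δ)
  have hk0 : 0 < k := by
    have : (0 : ℝ) < k := lt_of_lt_of_le (by positivity) hk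
    exact_mod_cast this
  have hC : 0 ≤ Real.log (((k : ℝ) + 1) / δ) := by
    refine Real.log_nonneg ?_
    rw [le_div_iff₀ hδ]
    have : (0 : ℝ) < k := by exact_mod_cast hk0
    linarith
  have hlog : Tendsto (fun t : ℕ => Real.log t) atTop atTop :=
    Real.tendsto_log_atTop.comp tendsto_natCast_atTop_atTop
  have hev := (hlog.eventually (DominatingModel.eventually_quadratic_le_exp k hk0 _ δ hC hδ)).and
    ((hlog.eventually_ge_atTop 1).and
      ((tendsto_natCast_atTop_atTop (R := ℝ)).eventually_ge_atTop (2 / δ)))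
  obtain ⟨t₀, ht₀⟩ := eventually_atTop.mp hev
  refine ⟨t₀, fun t ht => ?_⟩
  obtain ⟨hexp, hL, h2⟩ := ht₀ t ht
  rw [div_le_iff₀' hδ] at h2
  obtain ⟨n, hn, G, hG, hdeg⟩ := DominatingModel.exists_graph_of_large hδ hδ1 hk hL h2 hexp
  refine ⟨n, hn, G, hG, le_trans ?_ hdeg⟩
  rw [mul_assoc]
  gcongr
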